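/- Let $\mathcal H$ be a real Hilbert space, $L\ge 0$, and let $f:\mathcal H\to\mathbb R$ be convex and differentiable with $L$-Lipschitz continuous gradient and $\operatorname{argmin} f\neq\emptyset$. Let $0<p<2$, $\varepsilon_k=k^{-p}$ for $k\ge 1$, $\delta>0$, and let the step size $s>0$ satisfy $sL<1$. Let $x_0,x_1\in\mathcal H$ be arbitrary and let $(x_k)$ be generated by the Tikhonov regularized inertial gradient algorithm (TRIGA): for $k\ge1$, $$y_k=x_k+\bigl(1-\delta\sqrt{s\varepsilon_k}\bigr)(x_k-x_{k-1}),\qquad x_{k+1}=y_k-s\bigl(\nabla f(y_k)+\varepsilon_k y_k\bigr).$$ Then, for every $k\ge1$, the function $z\mapsto f(z)+\frac{\varepsilon_k}{2}\|z\|^2$ has a unique minimizer $x_{\varepsilon_k}$, the set $\operatorname{argmin} f$ has a unique element $x^*$ of minimal norm, and, as $k\to+\infty$: (i) $f(x_k)-\min_{\mathcal H} f=\mathcal O\bigl(k^{-p}\bigr)$; (ii) $\|x_k-x_{\varepsilon_k}\|^2=\mathcal O\bigl(k^{-(2-p)/2}\bigr)$, and $(x_k)$ converges strongly to $x^*$;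 (iii) $\|x_k-x_{k-1}\|=\mathcal O\bigl(k^{-(2+p)/4}\bigr)$. -/

import Mathlib

open Filter Topology Asymptotics

/-- `x` together with the auxiliary sequence `y` is a run of the Tikhonov regularized inertial
gradient algorithm for `f`, with damping `δ`, step size `s` and Tikhonov parameters `ε`. The
starting points `x 0` and `x 1` are arbitrary, and the updates are made for every `k ≥ 1`. -/
def IsTRIGA {H : Type*} [NormedAddCommGroup H] [InnerProductSpace ℝ H] [CompleteSpace H]
    (f : H → ℝ) (δ s : ℝ) (ε : ℕ → ℝ) (x y : ℕ → H) : Prop :=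
  ∀ k : ℕ, 1 ≤ k →
    y k = x k + (1 - δ * √(s * ε k)) • (x k - x (k - 1)) ∧
    x (k + 1) = y k - s • (gradient f (y k) + ε k • y k)

/-- The Tikhonov regularization `z ↦ f z + (ε / 2) ‖z‖ ^ 2` of `f`. -/
noncomputable def tikhonovReg {H : Type*} [NormedAddCommGroup H] (f : H → ℝ) (ε : ℝ) (z : H) : ℝ :=
  f z + ε / 2 * ‖z‖ ^ 2

/-- `z` is a global minimizer of `f`, that is, `z ∈ argmin f`. -/
def IsMinimizer {H : Type*} (f : H → ℝ) (z : H) : Prop :=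
  ∀ w : H, f z ≤ f w

/-- `z` is the one and only global minimizer of `f`. -/
def IsUniqueMinimizer {H : Type*} (f : H → ℝ) (z : H) : Prop :=
  IsMinimizer f z ∧ ∀ w : H, IsMinimizer f w → w = z

/-- `z` is an element of least norm of `argmin f`, and the only one. -/
def IsMinNormMinimizer {H : Type*} [NormedAddCommGroup H] (f : H → ℝ) (z : H) : Prop :=
  IsMinimizer f z ∧ ∀ w : H, IsMinimizer f w → ‖z‖ ≤ ‖w‖ ∧ (‖w‖ = ‖z‖ → w = z)

/-!
For a function `φ` with strong convexity modulus `μ`, minimizer `z` and `K`-Lipschitz gradient,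
`s K ≤ 1`, the inertial gradient method with extrapolation coefficient `(1 - τ) / (1 + τ)`, where
`τ ^ 2` is at most of order `s μ`, contracts the Lyapunov function
`(1 + τ)² s (φ u - φ z) + ½ ‖(1 + τ) (u - z) - (v - z)‖² + ½ τ² ‖v - z‖²` of the current iterate `u`
and the previous iterate `v` by a factor `1 - c τ`. The algorithm is this method, applied at
time `k` to `φ = f + (ε_k / 2) ‖·‖²`, with `τ` of order `√ε_k`, that is `k ^ (-p / 2)`.

Passing from `ε_k` to `ε_{k+1}` moves the minimizer by at most `2 R (1 - ε_{k+1} / ε_k)`, where `R`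
is the norm of a minimizer of `f`. It multiplies the Lyapunov function by at most `1 + O(1 / k)`,
which is negligible against the contraction since `p < 2`, and adds an error of order
`ε_k - ε_{k+1} = O(k ^ (-(1 + p)))`. Dividing the error by the contraction rate shows that the
Lyapunov function is `O(k ^ (-(1 + p / 2)))`. It bounds `s (φ u - φ z)`, hence also
`s (ε_k / 2) ‖u - z‖²`, and `‖u - v‖²`.

The regularized minimizers satisfy `‖z_ε - z_η‖² ≤ ‖z_ε‖² - ‖z_η‖²` for `ε ≤ η` and are bounded, so
they form a Cauchy family as `ε → 0`, and their limit is the minimizer of `f` of least norm.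
-/

section Minimizers

theorem exists_tendsto_of_sq_dist_le {X ι : Type*} [PseudoMetricSpace X] [CompleteSpace X]
    {l : Filter ι} [l.NeBot] {u : ι → X} {b : ι × ι → ℝ} (hb : Tendsto b (l ×ˢ l) (𝓝 0))
    (h : ∀ᶠ q in l ×ˢ l, dist (u q.1) (u q.2) ^ 2 ≤ b q) : ∃ z, Tendsto u l (𝓝 z) := by
  refine CompleteSpace.complete (cauchy_map_iff'.2 ?_)
  refine tendsto_uniformity_iff_dist_tendsto_zero.2 ?_
  have hsq : Tendsto (fun q : ι × ι => dist (u q.1) (u q.2) ^ 2) (l ×ˢ l) (𝓝 0) :=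
    squeeze_zero' (.of_forall fun _ => sq_nonneg _) h hb
  simpa only [Real.sqrt_sq dist_nonneg, Real.sqrt_zero] using hsq.sqrt

theorem le_of_lowerSemicontinuousAt_of_tendsto {X ι : Type*} [TopologicalSpace X] {l : Filter ι}
    [l.NeBot] {g : X → ℝ} {z : X} {u : ι → X} {b : ι → ℝ} {c : ℝ}
    (hg : LowerSemicontinuousAt g z) (hu : Tendsto u l (𝓝 z)) (hb : Tendsto b l (𝓝 c))
    (h : ∀ᶠ i in l, g (u i) ≤ b i) : g z ≤ c := by
  refine le_of_forall_lt fun d hd => ?_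
  obtain ⟨d', hdd', hd'⟩ := exists_between hd
  refine hdd'.trans_le (ge_of_tendsto hb ?_)
  filter_upwards [hu.eventually (hg d' hd'), h] with i hdi hi using hdi.le.trans hi

theorem IsMinimizer.iInf_eq {H : Type*} {f : H → ℝ} {z : H} (hz : IsMinimizer f z) :
    ⨅ w, f w = f z :=
  IsLeast.csInf_eq ⟨⟨z, rfl⟩, Set.forall_mem_range.2 hz⟩

variable {E : Type*} [NormedAddCommGroup E] [NormedSpace ℝ E] {g : E → ℝ} {m : ℝ}

theorem IsMinimizer.add_sq_norm_sub_le {z : E} (hz : IsMinimizer g z)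
    (hg : StrongConvexOn Set.univ m g) (w : E) : g z + m / 2 * ‖w - z‖ ^ 2 ≤ g w := by
  have hseg : ∀ᶠ t : ℝ in 𝓝[>] 0, (1 - t) * (m / 2 * ‖w - z‖ ^ 2) ≤ g w - g z := by
    filter_upwards [Ioo_mem_nhdsGT one_pos] with t ht
    have hconv := hg.2 (Set.mem_univ w) (Set.mem_univ z) ht.1.le (sub_nonneg.2 ht.2.le)
      (add_sub_cancel t 1)
    have hmin := hz (t • w + (1 - t) • z)
    simp only [smul_eq_mul] at hconv
    exact le_of_mul_le_mul_left (by linarith) ht.1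
  have hlim : Tendsto (fun t : ℝ => (1 - t) * (m / 2 * ‖w - z‖ ^ 2)) (𝓝[>] 0)
      (𝓝 ((1 - 0) * (m / 2 * ‖w - z‖ ^ 2))) :=
    ((tendsto_const_nhds.sub tendsto_id).mul_const _).mono_left nhdsWithin_le_nhds
  linarith [le_of_tendsto hlim hseg]

theorem IsMinimizer.isUniqueMinimizer {z : E} (hz : IsMinimizer g z)
    (hg : StrongConvexOn Set.univ m g) (hm : 0 < m) : IsUniqueMinimizer g z :=
  ⟨hz, fun _ hw => (hg.strictConvexOn hm).eq_of_isMinOn (fun v _ => hw v) (fun v _ => hz v)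
    (Set.mem_univ _) (Set.mem_univ _)⟩

theorem sq_norm_sub_le_of_strongConvexOn (hg : StrongConvexOn Set.univ m g)
    (hbdd : BddBelow (Set.range g)) (u v : E) :
    m / 8 * ‖u - v‖ ^ 2 ≤ (g u + g v) / 2 - ⨅ w, g w := by
  have hmid := hg.2 (Set.mem_univ u) (Set.mem_univ v) (by norm_num : (0 : ℝ) ≤ 1 / 2)
    (by norm_num : (0 : ℝ) ≤ 1 / 2) (by norm_num)
  simp only [smul_eq_mul] at hmid
  linarith [ciInf_le hbdd ((1 / 2 : ℝ) • u + (1 / 2 : ℝ) • v)]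

theorem exists_isMinimizer_of_strongConvexOn [CompleteSpace E] (hm : 0 < m)
    (hg : StrongConvexOn Set.univ m g) (hlsc : LowerSemicontinuous g)
    (hbdd : BddBelow (Set.range g)) : ∃ z, IsMinimizer g z := by
  set l : Filter E := comap g (𝓝 (⨅ w, g w))
  have hgl : Tendsto g l (𝓝 (⨅ w, g w)) := tendsto_comap
  have : l.NeBot := comap_neBot_iff_frequently.2 <|
    mem_closure_iff_frequently.1 (csInf_mem_closure (Set.range_nonempty g) hbdd)
  have hgap : Tendsto (fun q : E × E => 8 / m * ((g q.1 + g q.2) / 2 - ⨅ w, g w)) (l ×ˢ l)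
      (𝓝 0) := by
    have := ((((hgl.comp tendsto_fst).add (hgl.comp tendsto_snd)).div_const 2).sub_const
      (⨅ w, g w)).const_mul (8 / m)
    simpa only [Function.comp_apply, add_self_div_two, sub_self, mul_zero] using this
  obtain ⟨z, hz⟩ := exists_tendsto_of_sq_dist_le (u := id) hgap <| .of_forall fun q => by
    rw [id, id, dist_eq_norm, div_mul_eq_mul_div, le_div_iff₀ hm]
    linarith [sq_norm_sub_le_of_strongConvexOn hg hbdd q.1 q.2]
  have hmin : g z ≤ ⨅ w, g w :=
    le_of_lowerSemicontinuousAt_of_tendsto (hlsc z) hz hgl (.of_forall fun _ => le_rfl)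
  exact ⟨z, fun w => hmin.trans (ciInf_le hbdd w)⟩

end Minimizers

section TikhonovPath

theorem tikhonovReg_zero {E : Type*} [NormedAddCommGroup E] (f : E → ℝ) :
    tikhonovReg f 0 = f :=
  funext fun _ => by simp only [tikhonovReg, zero_div, zero_mul, add_zero]

theorem norm_le_of_isMinimizer_tikhonovReg {E : Type*} [NormedAddCommGroup E] {f : E → ℝ} {η : ℝ}
    {z w : E} (hη : 0 < η) (hz : IsMinimizer f z) (hw : IsMinimizer (tikhonovReg f η) w) :
    ‖w‖ ≤ ‖z‖ := by
  have hfz := hz w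
  have hreg := hw z
  simp only [tikhonovReg] at hreg
  have hsq : η / 2 * ‖w‖ ^ 2 ≤ η / 2 * ‖z‖ ^ 2 := by linarith
  exact (sq_le_sq₀ (norm_nonneg w) (norm_nonneg z)).1 (le_of_mul_le_mul_left hsq (half_pos hη))

variable {H : Type*} [NormedAddCommGroup H] [InnerProductSpace ℝ H] {f : H → ℝ} {ε η : ℝ}
  {z w : H}

theorem strongConvexOn_tikhonovReg (hf : ConvexOn ℝ Set.univ f) (ε : ℝ) :
    StrongConvexOn Set.univ ε (tikhonovReg f ε) := by
  rw [strongConvexOn_iff_convex]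
  simpa only [tikhonovReg, add_sub_cancel_right] using hf

theorem exists_isMinimizer_tikhonovReg [CompleteSpace H] (hf : ConvexOn ℝ Set.univ f)
    (hlsc : LowerSemicontinuous f) (hbdd : BddBelow (Set.range f)) (hε : 0 < ε) :
    ∃ z, IsMinimizer (tikhonovReg f ε) z := by
  refine exists_isMinimizer_of_strongConvexOn hε (strongConvexOn_tikhonovReg hf ε)
    (hlsc.add (by fun_prop : Continuous fun z : H => ε / 2 * ‖z‖ ^ 2).lowerSemicontinuous) ?_
  obtain ⟨b, hb⟩ := hbdd
  refine ⟨b, Set.forall_mem_range.2 fun z => (hb ⟨z, rfl⟩).trans ?_⟩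
  exact le_add_of_nonneg_right (by positivity)

theorem add_mul_sq_norm_sub_minimizers_le (hf : ConvexOn ℝ Set.univ f)
    (hz : IsMinimizer (tikhonovReg f ε) z) (hw : IsMinimizer (tikhonovReg f η) w) :
    (η + ε) * ‖z - w‖ ^ 2 ≤ (η - ε) * (‖z‖ ^ 2 - ‖w‖ ^ 2) := by
  have hz' := hz.add_sq_norm_sub_le (strongConvexOn_tikhonovReg hf ε) w
  have hw' := hw.add_sq_norm_sub_le (strongConvexOn_tikhonovReg hf η) z
  rw [norm_sub_rev] at hz'
  simp only [tikhonovReg] at hz' hw'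
  linarith

theorem sq_norm_sub_minimizers_le (hf : ConvexOn ℝ Set.univ f) (hε : 0 ≤ ε) (hη : 0 < η)
    (hεη : ε ≤ η) (hz : IsMinimizer (tikhonovReg f ε) z)
    (hw : IsMinimizer (tikhonovReg f η) w) : ‖z - w‖ ^ 2 ≤ ‖z‖ ^ 2 - ‖w‖ ^ 2 := by
  have h := add_mul_sq_norm_sub_minimizers_le hf hz hw
  have hpos : 0 ≤ ‖z‖ ^ 2 - ‖w‖ ^ 2 := by
    rcases hεη.lt_or_eq with hlt | rfl
    · exact nonneg_of_mul_nonneg_right (h.trans' (by positivity)) (sub_pos.2 hlt)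
    · have hzw : ‖z - w‖ ^ 2 = 0 := by nlinarith [sq_nonneg ‖z - w‖]
      rw [sub_eq_zero.1 (norm_eq_zero.1 ((pow_eq_zero_iff two_ne_zero).1 hzw)), sub_self]
  refine le_of_mul_le_mul_left (h.trans ?_) (add_pos_of_pos_of_nonneg hη hε)
  exact mul_le_mul_of_nonneg_right (by linarith) hpos

theorem add_mul_norm_sub_minimizers_le (hf : ConvexOn ℝ Set.univ f) (hεη : ε ≤ η)
    (hz : IsMinimizer (tikhonovReg f ε) z) (hw : IsMinimizer (tikhonovReg f η) w) :
    (η + ε) * ‖z - w‖ ≤ (η - ε) * (‖z‖ + ‖w‖) := by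
  rcases (norm_nonneg (z - w)).eq_or_lt with h0 | hpos
  · rw [← h0, mul_zero]
    exact mul_nonneg (sub_nonneg.2 hεη) (by positivity)
  refine le_of_mul_le_mul_right ?_ hpos
  calc (η + ε) * ‖z - w‖ * ‖z - w‖ = (η + ε) * ‖z - w‖ ^ 2 := by ring
    _ ≤ (η - ε) * ((‖z‖ + ‖w‖) * (‖z‖ - ‖w‖)) :=
        (add_mul_sq_norm_sub_minimizers_le hf hz hw).trans_eq (by ring)
    _ ≤ (η - ε) * ((‖z‖ + ‖w‖) * ‖z - w‖) := by
        gcongr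
        exact norm_sub_norm_le z w
    _ = (η - ε) * (‖z‖ + ‖w‖) * ‖z - w‖ := by ring

theorem norm_sub_minimizers_le {R : ℝ} (hf : ConvexOn ℝ Set.univ f) (hε : 0 ≤ ε) (hη : 0 < η)
    (hεη : ε ≤ η) (hz : IsMinimizer (tikhonovReg f ε) z) (hw : IsMinimizer (tikhonovReg f η) w)
    (hzR : ‖z‖ ≤ R) (hwR : ‖w‖ ≤ R) : ‖z - w‖ ≤ 2 * R * (1 - ε / η) := by
  have hR := mul_le_mul_of_nonneg_left (add_le_add hzR hwR) (sub_nonneg.2 hεη)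
  rw [one_sub_div hη.ne', mul_div_assoc', le_div_iff₀ hη]
  linarith [add_mul_norm_sub_minimizers_le hf hεη hz hw, mul_nonneg hε (norm_nonneg (z - w))]

theorem exists_tendsto_tikhonov_path [CompleteSpace H] (hf : ConvexOn ℝ Set.univ f)
    (hz : IsMinimizer f z) {path : ℝ → H}
    (hpath : ∀ ε > 0, IsMinimizer (tikhonovReg f ε) (path ε)) :
    ∃ xstar, Tendsto path (𝓝[>] 0) (𝓝 xstar) := by
  have hdist {ε η : ℝ} (hε : 0 < ε) (hεη : ε ≤ η) :
      ‖path ε - path η‖ ^ 2 ≤ ‖path ε‖ ^ 2 - ‖path η‖ ^ 2 :=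
    sq_norm_sub_minimizers_le hf hε.le (hε.trans_le hεη) hεη (hpath ε hε)
      (hpath η (hε.trans_le hεη))
  have hanti : AntitoneOn (fun ε => ‖path ε‖ ^ 2) (Set.Ioi 0) := fun ε hε η _ hεη => by
    linarith [hdist hε hεη, sq_nonneg ‖path ε - path η‖]
  have hbdd : BddAbove ((fun ε => ‖path ε‖ ^ 2) '' Set.Ioi 0) :=
    ⟨‖z‖ ^ 2, Set.forall_mem_image.2 fun ε hε =>
      pow_le_pow_left₀ (norm_nonneg _) (norm_le_of_isMinimizer_tikhonovReg hε hz (hpath ε hε)) 2⟩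
  have hnorm := hanti.tendsto_nhdsGT hbdd
  have hgap : Tendsto (fun q : ℝ × ℝ => |‖path q.1‖ ^ 2 - ‖path q.2‖ ^ 2|)
      (𝓝[>] 0 ×ˢ 𝓝[>] 0) (𝓝 0) := by
    simpa only [Function.comp_apply, sub_self, abs_zero] using
      ((hnorm.comp tendsto_fst).sub (hnorm.comp tendsto_snd)).abs
  refine exists_tendsto_of_sq_dist_le hgap ?_
  filter_upwards [prod_mem_prod self_mem_nhdsWithin self_mem_nhdsWithin] with q hq
  rw [dist_eq_norm]
  rcases le_total q.1 q.2 with hle | hle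
  · exact (hdist hq.1 hle).trans (le_abs_self _)
  · rw [norm_sub_rev, abs_sub_comm]
    exact (hdist hq.2 hle).trans (le_abs_self _)

theorem isMinNormMinimizer_of_tendsto_tikhonov_path (hf : ConvexOn ℝ Set.univ f)
    (hlsc : LowerSemicontinuous f) {path : ℝ → H} {xstar : H}
    (hpath : ∀ ε > 0, IsMinimizer (tikhonovReg f ε) (path ε))
    (hlim : Tendsto path (𝓝[>] 0) (𝓝 xstar)) : IsMinNormMinimizer f xstar := by
  have hmin : IsMinimizer f xstar := fun w => by
    have hb : Tendsto (fun ε => f w + ε / 2 * ‖w‖ ^ 2) (𝓝[>] 0) (𝓝 (f w + 0 / 2 * ‖w‖ ^ 2)) :=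
      ((tendsto_id.div_const 2).mul_const _).const_add _ |>.mono_left nhdsWithin_le_nhds
    rw [zero_div, zero_mul, add_zero] at hb
    refine le_of_lowerSemicontinuousAt_of_tendsto (hlsc xstar) hlim hb ?_
    filter_upwards [self_mem_nhdsWithin] with ε hε
    have hε' : 0 ≤ ε / 2 * ‖path ε‖ ^ 2 := mul_nonneg (half_pos hε).le (sq_nonneg _)
    exact (le_add_of_nonneg_right hε').trans (hpath ε hε w)
  refine ⟨hmin, fun w hw => ?_⟩
  have hdist : ‖w - xstar‖ ^ 2 ≤ ‖w‖ ^ 2 - ‖xstar‖ ^ 2 := by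
    refine le_of_tendsto_of_tendsto ((hlim.const_sub w).norm.pow 2)
      ((hlim.norm.pow 2).const_sub _) ?_
    filter_upwards [self_mem_nhdsWithin] with ε hε
    exact sq_norm_sub_minimizers_le hf le_rfl hε (le_of_lt hε) ((tikhonovReg_zero f).symm ▸ hw)
      (hpath ε hε)
  refine ⟨(sq_le_sq₀ (norm_nonneg _) (norm_nonneg _)).1 ?_, fun heq => ?_⟩
  · linarith [sq_nonneg ‖w - xstar‖]
  · rw [heq, sub_self] at hdist
    exact sub_eq_zero.1 (norm_eq_zero.1 ((pow_eq_zero_iff two_ne_zero).1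
      (hdist.antisymm (sq_nonneg _))))

end TikhonovPath

section GradientStep

variable {H : Type*} [NormedAddCommGroup H] [InnerProductSpace ℝ H] [CompleteSpace H]
  {f : H → ℝ} {g : H → H}

theorem hasDerivAt_comp_add_smul {G y v : H} {t : ℝ} (hf : HasGradientAt f G (y + t • v)) :
    HasDerivAt (fun t : ℝ => f (y + t • v)) (inner ℝ G v) t := by
  have hline : HasDerivAt (fun t : ℝ => y + t • v) v t := by
    simpa using ((hasDerivAt_id t).smul_const v).const_add y
  exact hf.hasFDerivAt.comp_hasDerivAt t hline

theorem add_inner_gradient_le {G y : H} (hc : ConvexOn ℝ Set.univ f) (hf : HasGradientAt f G y)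
    (z : H) : f y + inner ℝ G (z - y) ≤ f z := by
  have hline : ConvexOn ℝ Set.univ fun t : ℝ => f (AffineMap.lineMap y z t) :=
    hc.comp_affineMap (AffineMap.lineMap y z)
  have hderiv : HasDerivAt (fun t : ℝ => f (AffineMap.lineMap y z t)) (inner ℝ G (z - y)) 0 := by
    simp only [AffineMap.lineMap_apply_module']
    simpa only [add_comm] using
      hasDerivAt_comp_add_smul (y := y) (v := z - y) (t := 0) (by simpa using hf)
  have hslope := hline.le_slope_of_hasDerivAt (Set.mem_univ 0) (Set.mem_univ 1) one_pos hderiv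
  simp only [slope_def_field, AffineMap.lineMap_apply_one, AffineMap.lineMap_apply_zero, sub_zero,
    div_one] at hslope
  linarith

theorem le_add_inner_gradient_add_sq {K : NNReal} (hf : ∀ z, HasGradientAt f (g z) z)
    (hg : LipschitzWith K g) (y v : H) :
    f (y + v) ≤ f y + inner ℝ (g y) v + K / 2 * ‖v‖ ^ 2 := by
  have hderiv (t : ℝ) : HasDerivAt (fun t : ℝ => f (y + t • v)) (inner ℝ (g (y + t • v)) v) t :=
    hasDerivAt_comp_add_smul (hf _)
  have hbound (t : ℝ) : HasDerivAt
      (fun t : ℝ => f y + t * inner ℝ (g y) v + t ^ 2 * (K / 2 * ‖v‖ ^ 2))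
      (inner ℝ (g y) v + t * (K * ‖v‖ ^ 2)) t := by
    refine ((((hasDerivAt_id t).mul_const _).const_add _).add
      ((hasDerivAt_pow 2 t).mul_const _)).congr_deriv ?_
    norm_num
    ring
  have hle : ∀ t ∈ Set.Ico (0 : ℝ) 1,
      inner ℝ (g (y + t • v)) v ≤ inner ℝ (g y) v + t * (K * ‖v‖ ^ 2) := fun t ht => by
    have hlip : ‖g (y + t • v) - g y‖ ≤ K * (t * ‖v‖) := by
      simpa [norm_smul, abs_of_nonneg ht.1] using hg.norm_sub_le (y + t • v) y
    have hinner := real_inner_le_norm (g (y + t • v) - g y) v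
    rw [inner_sub_left] at hinner
    linarith [mul_le_mul_of_nonneg_right hlip (norm_nonneg v)]
  have h := image_le_of_deriv_right_le_deriv_boundary
    (fun t _ => (hderiv t).continuousAt.continuousWithinAt)
    (fun t _ => (hderiv t).hasDerivWithinAt) (by simp)
    (fun t _ => (hbound t).continuousAt.continuousWithinAt)
    (fun t _ => (hbound t).hasDerivWithinAt) hle (Set.right_mem_Icc.2 zero_le_one)
  simpa using h

theorem gradient_step_le {K : NNReal} {s : ℝ} (hc : ConvexOn ℝ Set.univ f)
    (hf : ∀ z, HasGradientAt f (g z) z) (hg : LipschitzWith K g) (hs : 0 ≤ s) (hsK : s * K ≤ 1)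
    (y w : H) :
    s * f (y - s • g y) ≤ s * f w + inner ℝ (s • g y) (y - w) - 1 / 2 * ‖s • g y‖ ^ 2 := by
  have hdescent : s * f (y - s • g y)
      ≤ s * (f y - inner ℝ (g y) (s • g y)) + s * K / 2 * ‖s • g y‖ ^ 2 := by
    have h := le_add_inner_gradient_add_sq hf hg y (-(s • g y))
    rw [← sub_eq_add_neg, inner_neg_right, norm_neg] at h
    linarith [mul_le_mul_of_nonneg_left h hs]
  have hconv : s * (f y - inner ℝ (g y) (y - w)) ≤ s * f w := by
    have h := add_inner_gradient_le hc (hf y) w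
    rw [← neg_sub, inner_neg_right] at h
    exact mul_le_mul_of_nonneg_left (by linarith) hs
  have hsmooth := mul_le_mul_of_nonneg_right hsK (sq_nonneg ‖s • g y‖)
  have hinner : s * inner ℝ (g y) (s • g y) = ‖s • g y‖ ^ 2 := by
    rw [← real_inner_smul_left, real_inner_self_eq_norm_sq]
  rw [real_inner_smul_left]
  linarith

theorem hasGradientAt_tikhonovReg {G z : H} (hf : HasGradientAt f G z) (ε : ℝ) :
    HasGradientAt (tikhonovReg f ε) (G + ε • z) z := by
  have hsq : HasFDerivAt (fun z : H => ε / 2 * ‖z‖ ^ 2) ((ε / 2) • 2 • innerSL ℝ z) z :=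
    (hasStrictFDerivAt_norm_sq z).hasFDerivAt.const_mul (ε / 2)
  refine (hf.hasFDerivAt.add hsq).congr_fderiv ?_
  ext v
  simp only [add_apply, InnerProductSpace.toDual_apply_apply, smul_apply, coe_innerSL_apply,
    nsmul_eq_mul, Nat.cast_ofNat, smul_eq_mul, map_add, map_smul, add_right_inj]
  ring

end GradientStep

section Lyapunov

variable {H : Type*} [NormedAddCommGroup H] [InnerProductSpace ℝ H] {ρ τ ζ : ℝ}

theorem sq_norm_add_le_one_add_mul (hζ : 0 < ζ) (a b : H) :
    ‖a + b‖ ^ 2 ≤ (1 + ζ) * ‖a‖ ^ 2 + (1 + 1 / ζ) * ‖b‖ ^ 2 := by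
  have hyoung : 0 ≤ 1 / ζ * ‖ζ • a - b‖ ^ 2 := by positivity
  have hexpand : 1 / ζ * ‖ζ • a - b‖ ^ 2 = ζ * ‖a‖ ^ 2 - 2 * inner ℝ a b + 1 / ζ * ‖b‖ ^ 2 := by
    rw [norm_sub_sq_real, norm_smul, real_inner_smul_left, mul_pow, Real.norm_eq_abs, sq_abs]
    field_simp
  rw [norm_add_sq_real]
  linarith

/-- The quadratic part of the Lyapunov function, in the displacements `a`, `b` of the current and of
the previous iterate from the minimizer. Up to the second term it is the kinetic energy of
`(a - b) + τ • a`, as for the damped oscillator. -/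
noncomputable def inertialQuad (τ : ℝ) (a b : H) : ℝ :=
  1 / 2 * ‖(1 + τ) • a - b‖ ^ 2 + τ ^ 2 / 2 * ‖b‖ ^ 2

theorem inertialQuad_nonneg (τ : ℝ) (a b : H) : 0 ≤ inertialQuad τ a b := by
  unfold inertialQuad
  positivity

theorem inertialQuad_extrapolate (hτ : 1 + τ ≠ 0) (a b : H) :
    inertialQuad τ (a + ((1 - τ) / (1 + τ)) • (a - b)) a
      = inertialQuad τ a b - τ * ‖a - b‖ ^ 2 := by
  have hnew : (1 + τ) • (a + ((1 - τ) / (1 + τ)) • (a - b)) - a = a - (1 - τ) • b := by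
    rw [smul_add, smul_smul, mul_div_cancel₀ _ hτ]
    module
  simp only [inertialQuad, hnew, norm_sub_sq_real, norm_smul, real_inner_smul_left,
    real_inner_smul_right, mul_pow, Real.norm_eq_abs, sq_abs]
  ring

theorem sq_norm_sub_le_inertialQuad (hτ : 0 ≤ τ) (a b : H) :
    ‖a - b‖ ^ 2 ≤ 4 * inertialQuad τ a b := by
  have hsplit : (1 + τ) • (a - b) = ((1 + τ) • a - b) - τ • b := by module
  calc ‖a - b‖ ^ 2 ≤ ((1 + τ) * ‖a - b‖) ^ 2 :=
        pow_le_pow_left₀ (norm_nonneg _) (le_mul_of_one_le_left (norm_nonneg _) (by linarith)) 2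
    _ = ‖((1 + τ) • a - b) - τ • b‖ ^ 2 := by
        rw [← hsplit, norm_smul, Real.norm_of_nonneg (by linarith)]
    _ ≤ 2 * (‖(1 + τ) • a - b‖ ^ 2 + ‖τ • b‖ ^ 2) := by
        linarith [parallelogram_law_with_norm ℝ ((1 + τ) • a - b) (τ • b),
          sq_nonneg ‖((1 + τ) • a - b) + τ • b‖]
    _ = 4 * inertialQuad τ a b := by
        rw [norm_smul, mul_pow, Real.norm_eq_abs, sq_abs, inertialQuad]
        ring

theorem inertialQuad_le (hτ0 : 0 ≤ τ) (hτ1 : τ ≤ 1) (a b : H) :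
    inertialQuad τ a b ≤ 2 * (‖a - b‖ ^ 2 + τ ^ 2 * ‖a‖ ^ 2) := by
  have hsplit : (1 + τ) • a - b = (a - b) + τ • a := by module
  have hkin := parallelogram_law_with_norm ℝ (a - b) (τ • a)
  have hpos := parallelogram_law_with_norm ℝ a (a - b)
  rw [norm_smul, Real.norm_of_nonneg hτ0] at hkin
  rw [sub_sub_cancel] at hpos
  rw [inertialQuad, hsplit]
  nlinarith [sq_nonneg ‖(a - b) - τ • a‖, mul_nonneg (sq_nonneg τ) (sq_nonneg ‖a + (a - b)‖),
    mul_nonneg (sub_nonneg.2 (pow_le_one₀ (n := 2) hτ0 hτ1)) (sq_nonneg ‖a - b‖)]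

theorem inertialQuad_one_sub_mul_le (hρ0 : 0 ≤ ρ) (hρ1 : ρ ≤ 1) (hτ : 0 ≤ τ) (a b : H) :
    inertialQuad ((1 - ρ) * τ) a b ≤ (1 + 2 * ρ) * inertialQuad τ a b := by
  have hsplit : (1 + (1 - ρ) * τ) • a - b
      = (1 - ρ) • ((1 + τ) • a - b) + ρ • (a - b) := by module
  have hconvex : ‖(1 + (1 - ρ) * τ) • a - b‖ ^ 2
      ≤ (1 - ρ) * ‖(1 + τ) • a - b‖ ^ 2 + ρ * ‖a - b‖ ^ 2 := by
    have h := (convexOn_univ_norm (E := H)).pow (fun _ _ => norm_nonneg _) 2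
    simpa only [hsplit, Pi.pow_apply, smul_eq_mul] using
      h.2 (Set.mem_univ ((1 + τ) • a - b)) (Set.mem_univ (a - b)) (sub_nonneg.2 hρ1) hρ0
        (sub_add_cancel 1 ρ)
  have hvel := mul_le_mul_of_nonneg_left (sq_norm_sub_le_inertialQuad hτ a b) hρ0
  have hscale : ((1 - ρ) * τ) ^ 2 ≤ τ ^ 2 :=
    pow_le_pow_left₀ (mul_nonneg (sub_nonneg.2 hρ1) hτ) (mul_le_of_le_one_left hτ (by linarith)) 2
  have hprev := mul_le_mul_of_nonneg_right hscale (sq_nonneg ‖b‖)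
  simp only [inertialQuad] at hvel ⊢
  nlinarith [mul_nonneg hρ0 (sq_nonneg ‖(1 + τ) • a - b‖)]

theorem inertialQuad_add_le (hζ : 0 < ζ) (τ : ℝ) (a b c : H) :
    inertialQuad τ (a + c) (b + c)
      ≤ (1 + ζ) * inertialQuad τ a b + (1 + 1 / ζ) * (τ ^ 2 * ‖c‖ ^ 2) := by
  have hsplit : (1 + τ) • (a + c) - (b + c) = ((1 + τ) • a - b) + τ • c := by module
  have hkin := sq_norm_add_le_one_add_mul hζ ((1 + τ) • a - b) (τ • c)
  have hpos := mul_le_mul_of_nonneg_left (sq_norm_add_le_one_add_mul hζ b c) (sq_nonneg τ)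
  rw [norm_smul, mul_pow, Real.norm_eq_abs, sq_abs] at hkin
  rw [inertialQuad, inertialQuad, hsplit]
  linarith

/-- The Lyapunov function of the inertial gradient method for `φ` with step size `s` and momentum
parameter `τ`, at the current iterate `u` and the previous iterate `v`; `z` is the minimizer
of `φ`. -/
noncomputable def lyapunov (φ : H → ℝ) (s τ : ℝ) (z u v : H) : ℝ :=
  (1 + τ) ^ 2 * (s * (φ u - φ z)) + inertialQuad τ (u - z) (v - z)

variable {φ : H → ℝ} {s : ℝ} {z : H}

theorem mul_sub_le_lyapunov (hs : 0 ≤ s) (hτ : 0 ≤ τ) (hz : IsMinimizer φ z) (u v : H) :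
    s * (φ u - φ z) ≤ lyapunov φ s τ z u v := by
  have hgap : 0 ≤ s * (φ u - φ z) := mul_nonneg hs (sub_nonneg.2 (hz u))
  have hfactor : 1 ≤ (1 + τ) ^ 2 := one_le_pow₀ (le_add_of_nonneg_right hτ)
  exact (le_mul_of_one_le_left hgap hfactor).trans
    (le_add_of_nonneg_right (inertialQuad_nonneg _ _ _))

theorem sq_norm_sub_le_lyapunov (hs : 0 ≤ s) (hτ : 0 ≤ τ) (hz : IsMinimizer φ z) (u v : H) :
    ‖u - v‖ ^ 2 ≤ 4 * lyapunov φ s τ z u v := by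
  have hvel := sq_norm_sub_le_inertialQuad hτ (u - z) (v - z)
  rw [sub_sub_sub_cancel_right] at hvel
  have hgap : 0 ≤ (1 + τ) ^ 2 * (s * (φ u - φ z)) :=
    mul_nonneg (sq_nonneg _) (mul_nonneg hs (sub_nonneg.2 (hz u)))
  rw [lyapunov]
  linarith

theorem lyapunov_nonneg (hs : 0 ≤ s) (hz : IsMinimizer φ z) (τ : ℝ) (u v : H) :
    0 ≤ lyapunov φ s τ z u v :=
  add_nonneg (mul_nonneg (sq_nonneg _) (mul_nonneg hs (sub_nonneg.2 (hz u))))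
    (inertialQuad_nonneg _ _ _)

theorem lyapunov_le {κ μ : ℝ} (hφ : StrongConvexOn Set.univ μ φ) (hz : IsMinimizer φ z)
    (hs : 0 ≤ s) (hτ0 : 0 ≤ τ) (hτ1 : τ ≤ 1) (hτ : τ ^ 2 ≤ κ ^ 2 * (s * μ)) (u v : H) :
    lyapunov φ s τ z u v ≤ 4 * (1 + κ ^ 2) * (s * (φ u - φ z) + ‖u - v‖ ^ 2) := by
  have hgap : 0 ≤ s * (φ u - φ z) := mul_nonneg hs (sub_nonneg.2 (hz u))
  have hgrowth : s * (μ / 2 * ‖u - z‖ ^ 2) ≤ s * (φ u - φ z) :=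
    mul_le_mul_of_nonneg_left (by linarith [hz.add_sq_norm_sub_le hφ u]) hs
  have hvalue : (1 + τ) ^ 2 * (s * (φ u - φ z)) ≤ 4 * (s * (φ u - φ z)) :=
    mul_le_mul_of_nonneg_right (by nlinarith) hgap
  have hquad := inertialQuad_le hτ0 hτ1 (u - z) (v - z)
  rw [sub_sub_sub_cancel_right] at hquad
  have hdist : τ ^ 2 * ‖u - z‖ ^ 2 ≤ 2 * κ ^ 2 * (s * (φ u - φ z)) :=
    calc τ ^ 2 * ‖u - z‖ ^ 2 ≤ κ ^ 2 * (s * μ) * ‖u - z‖ ^ 2 := by gcongr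
      _ = 2 * κ ^ 2 * (s * (μ / 2 * ‖u - z‖ ^ 2)) := by ring
      _ ≤ 2 * κ ^ 2 * (s * (φ u - φ z)) := by gcongr
  have hvel : 0 ≤ (2 + 4 * κ ^ 2) * ‖u - v‖ ^ 2 := by positivity
  rw [lyapunov]
  linarith

section Step

variable [CompleteSpace H] {g : H → H} {K : NNReal}

theorem lyapunov_gradient_step_le (hφ : ConvexOn ℝ Set.univ φ) (hg : ∀ w, HasGradientAt φ (g w) w)
    (hK : LipschitzWith K g) (hs : 0 ≤ s) (hsK : s * K ≤ 1) (hτ : 0 ≤ τ) (z u y : H) :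
    lyapunov φ s τ z (y - s • g y) u
      ≤ (1 + τ) * (s * (φ u - φ z)) + inertialQuad τ (y - z) (u - z) := by
  have hu := mul_le_mul_of_nonneg_left (gradient_step_le hφ hg hK hs hsK y u)
    (by linarith : 0 ≤ 1 + τ)
  have hz := mul_le_mul_of_nonneg_left (gradient_step_le hφ hg hK hs hsK y z)
    (by positivity : 0 ≤ τ * (1 + τ))
  set G := s • g y
  have hnew : (1 + τ) • (y - G - z) - (u - z) = ((1 + τ) • (y - z) - (u - z)) - (1 + τ) • G := by
    module
  have hdir : (1 + τ) • (y - z) - (u - z) = (y - u) + τ • (y - z) := by module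
  simp only [lyapunov, inertialQuad, hnew]
  rw [norm_sub_sq_real _ ((1 + τ) • G), norm_smul, Real.norm_eq_abs, mul_pow, sq_abs,
    real_inner_smul_right, real_inner_comm, hdir, inner_add_right, real_inner_smul_right]
  linarith

theorem lyapunov_inertial_step_le (hφ : ConvexOn ℝ Set.univ φ)
    (hg : ∀ w, HasGradientAt φ (g w) w) (hK : LipschitzWith K g) (hs : 0 ≤ s) (hsK : s * K ≤ 1)
    (hτ : 0 ≤ τ) {u v y : H} (hy : y = u + ((1 - τ) / (1 + τ)) • (u - v)) (z : H) :
    lyapunov φ s τ z (y - s • g y) u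
      ≤ lyapunov φ s τ z u v - τ * ((1 + τ) * (s * (φ u - φ z)) + ‖u - v‖ ^ 2) := by
  have hquad : inertialQuad τ (y - z) (u - z)
      = inertialQuad τ (u - z) (v - z) - τ * ‖u - v‖ ^ 2 := by
    have h := inertialQuad_extrapolate (by linarith : 1 + τ ≠ 0) (u - z) (v - z)
    rwa [sub_sub_sub_cancel_right, sub_add_eq_add_sub, ← hy] at h
  have h := lyapunov_gradient_step_le hφ hg hK hs hsK hτ z u y
  rw [hquad] at h
  refine h.trans_eq ?_
  rw [lyapunov]
  ring

theorem lyapunov_inertial_step_le_mul {κ μ : ℝ} (hφ : StrongConvexOn Set.univ μ φ) (hμ : 0 ≤ μ)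
    (hg : ∀ w, HasGradientAt φ (g w) w) (hK : LipschitzWith K g) (hs : 0 ≤ s) (hsK : s * K ≤ 1)
    (hτ0 : 0 ≤ τ) (hτ1 : τ ≤ 1) (hτ : τ ^ 2 ≤ κ ^ 2 * (s * μ)) (hz : IsMinimizer φ z)
    {u v y : H} (hy : y = u + ((1 - τ) / (1 + τ)) • (u - v)) :
    lyapunov φ s τ z (y - s • g y) u
      ≤ (1 - τ / (4 * (1 + κ ^ 2))) * lyapunov φ s τ z u v := by
  have hstep := lyapunov_inertial_step_le (strongConvexOn_zero.1 (hφ.mono hμ)) hg hK hs hsK hτ0 hy z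
  have hdecrease : τ / (4 * (1 + κ ^ 2)) * lyapunov φ s τ z u v
      ≤ τ * (s * (φ u - φ z) + ‖u - v‖ ^ 2) := by
    rw [div_mul_eq_mul_div, div_le_iff₀ (by positivity), mul_assoc, mul_comm (_ + _)]
    exact mul_le_mul_of_nonneg_left (lyapunov_le hφ hz hs hτ0 hτ1 hτ u v) hτ0
  have hgap : 0 ≤ τ ^ 2 * (s * (φ u - φ z)) :=
    mul_nonneg (sq_nonneg _) (mul_nonneg hs (sub_nonneg.2 (hz u)))
  linarith

end Step

theorem lyapunov_tikhonovReg_drift_le {f : H → ℝ} {ε ε' : ℝ} {z' : H} (hεε' : ε' ≤ ε)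
    (hz : IsMinimizer (tikhonovReg f ε) z) (hz' : IsMinimizer (tikhonovReg f ε') z')
    (hs : 0 ≤ s) (hρ0 : 0 ≤ ρ) (hρ1 : ρ ≤ 1) (hτ : 0 ≤ τ) (hζ : 0 < ζ) (u v : H) :
    lyapunov (tikhonovReg f ε') s ((1 - ρ) * τ) z' u v
      ≤ (1 + ζ) * (1 + 2 * ρ) * lyapunov (tikhonovReg f ε) s τ z u v
        + (1 + τ) ^ 2 * (s * ((ε - ε') / 2 * ‖z'‖ ^ 2))
        + (1 + 1 / ζ) * (τ ^ 2 * ‖z - z'‖ ^ 2) := by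
  have : 0 ≤ (1 - ρ) * τ := mul_nonneg (sub_nonneg.2 hρ1) hτ
  have hτ'τ : (1 - ρ) * τ ≤ τ := mul_le_of_le_one_left hτ (by linarith)
  have hquad : inertialQuad ((1 - ρ) * τ) (u - z') (v - z')
      ≤ (1 + ζ) * ((1 + 2 * ρ) * inertialQuad τ (u - z) (v - z))
        + (1 + 1 / ζ) * (τ ^ 2 * ‖z - z'‖ ^ 2) := by
    have h := inertialQuad_add_le hζ ((1 - ρ) * τ) (u - z) (v - z) (z - z')
    rw [sub_add_sub_cancel, sub_add_sub_cancel] at h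
    refine h.trans ?_
    gcongr
    exact inertialQuad_one_sub_mul_le hρ0 hρ1 hτ _ _
  have hgap : 0 ≤ s * (tikhonovReg f ε u - tikhonovReg f ε z) :=
    mul_nonneg hs (sub_nonneg.2 (hz u))
  have hdrift : tikhonovReg f ε' u - tikhonovReg f ε' z'
      ≤ tikhonovReg f ε u - tikhonovReg f ε z + (ε - ε') / 2 * ‖z'‖ ^ 2 := by
    have hmin := hz z'
    have hu := mul_le_mul_of_nonneg_right hεε' (sq_nonneg ‖u‖)
    simp only [tikhonovReg] at hmin ⊢
    linarith
  have hvalue : (1 + (1 - ρ) * τ) ^ 2 * (s * (tikhonovReg f ε' u - tikhonovReg f ε' z'))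
      ≤ (1 + τ) ^ 2 * (s * (tikhonovReg f ε u - tikhonovReg f ε z))
        + (1 + τ) ^ 2 * (s * ((ε - ε') / 2 * ‖z'‖ ^ 2)) := by
    rw [← mul_add, ← mul_add]
    gcongr
    exact mul_nonneg hs (sub_nonneg.2 (hz' u))
  have hfactor := le_mul_of_one_le_left
    (mul_nonneg (sq_nonneg (1 + τ)) hgap)
    (one_le_mul_of_one_le_of_one_le (by linarith : 1 ≤ 1 + ζ) (by linarith : 1 ≤ 1 + 2 * ρ))
  simp only [lyapunov]
  linarith

end Lyapunov

section Momentum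

/-- The parameter `τ` for which the extrapolation coefficient `1 - θ` of the algorithm takes the
form `(1 - τ) / (1 + τ)`. -/
noncomputable def momentumParam (θ : ℝ) : ℝ := θ / (2 - θ)

variable {θ θ' : ℝ}

theorem one_sub_momentumParam_div (hθ : θ ≠ 2) :
    (1 - momentumParam θ) / (1 + momentumParam θ) = 1 - θ := by
  have h2 : 2 - θ ≠ 0 := sub_ne_zero.2 hθ.symm
  have hden : 1 + momentumParam θ = 2 / (2 - θ) := by
    rw [momentumParam]
    field_simp
    ring
  rw [hden, momentumParam]
  field_simp
  ring

theorem half_le_momentumParam (hθ0 : 0 ≤ θ) (hθ2 : θ < 2) : θ / 2 ≤ momentumParam θ :=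
  div_le_div_of_nonneg_left hθ0 (by linarith) (by linarith)

theorem momentumParam_nonneg (hθ0 : 0 ≤ θ) (hθ2 : θ ≤ 2) : 0 ≤ momentumParam θ :=
  div_nonneg hθ0 (sub_nonneg.2 hθ2)

theorem momentumParam_le (hθ0 : 0 ≤ θ) (hθ1 : θ ≤ 1) : momentumParam θ ≤ θ :=
  div_le_self hθ0 (by linarith)

theorem exists_momentumParam_eq_one_sub_mul (hθ : 0 < θ) (hθ1 : θ ≤ 1) (hθ'0 : 0 ≤ θ')
    (hθ' : θ' ≤ θ) :
    ∃ ρ, 0 ≤ ρ ∧ ρ ≤ 1 ∧ ρ ≤ 2 * (1 - θ' / θ) ∧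
      momentumParam θ' = (1 - ρ) * momentumParam θ := by
  have hden : 0 < 2 - θ := by linarith
  have hden' : 0 < 2 - θ' := by linarith
  have hdrop : 0 ≤ (θ - θ') / θ := div_nonneg (sub_nonneg.2 hθ') hθ.le
  refine ⟨(θ - θ') / θ * (2 / (2 - θ')), by positivity, ?_, ?_, ?_⟩
  · rw [div_mul_div_comm, div_le_one (by positivity)]
    linarith [mul_le_mul_of_nonneg_right hθ1 hθ'0]
  · rw [one_sub_div hθ.ne', mul_comm]
    exact mul_le_mul_of_nonneg_right (div_le_self zero_le_two (by linarith)) hdrop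
  · rw [momentumParam, momentumParam]
    field_simp
    ring

end Momentum

section TikhonovEnergy

variable {H : Type*} [NormedAddCommGroup H] [InnerProductSpace ℝ H]
  {f : H → ℝ} {L : NNReal} {δ s : ℝ}

/-- The Lyapunov function of the regularized problem `tikhonovReg f ε`, at the current iterate `u`
and the previous iterate `v`; `z` is the minimizer of `tikhonovReg f ε`. -/
noncomputable def tikhonovEnergy (f : H → ℝ) (δ s ε : ℝ) (z u v : H) : ℝ :=
  lyapunov (tikhonovReg f ε) s (momentumParam (δ * √(s * ε))) z u v

theorem mul_sub_le_tikhonovEnergy {ε : ℝ} {z z₀ : H} (hδ : 0 ≤ δ) (hs : 0 ≤ s) (hε : 0 ≤ ε)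
    (hθ : δ * √(s * ε) ≤ 2) (hz : IsMinimizer (tikhonovReg f ε) z) (u v : H) :
    s * (f u - f z₀) ≤ tikhonovEnergy f δ s ε z u v + s * (ε / 2 * ‖z₀‖ ^ 2) := by
  have hgap := mul_sub_le_lyapunov hs (momentumParam_nonneg (by positivity) hθ) hz u v
  have hmin := mul_le_mul_of_nonneg_left (hz z₀) hs
  have hu : 0 ≤ s * (ε / 2 * ‖u‖ ^ 2) := by positivity
  rw [← tikhonovEnergy] at hgap
  simp only [tikhonovReg] at hgap hmin
  linarith

theorem mul_sq_norm_sub_le_tikhonovEnergy {ε : ℝ} {z : H} (hf : ConvexOn ℝ Set.univ f)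
    (hδ : 0 ≤ δ) (hs : 0 ≤ s) (hθ : δ * √(s * ε) ≤ 2) (hz : IsMinimizer (tikhonovReg f ε) z)
    (u v : H) : s * (ε / 2 * ‖u - z‖ ^ 2) ≤ tikhonovEnergy f δ s ε z u v := by
  refine le_trans ?_ (mul_sub_le_lyapunov hs (momentumParam_nonneg (by positivity) hθ) hz u v)
  have hgrowth := hz.add_sq_norm_sub_le (strongConvexOn_tikhonovReg hf ε) u
  gcongr
  linarith

theorem momentumParam_sq_le {ε : ℝ} (hδ : 0 ≤ δ) (hsε : 0 ≤ s * ε) (hθ : δ * √(s * ε) ≤ 1) :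
    momentumParam (δ * √(s * ε)) ^ 2 ≤ δ ^ 2 * (s * ε) := by
  have hθsq : δ ^ 2 * (s * ε) = (δ * √(s * ε)) ^ 2 := by rw [mul_pow, Real.sq_sqrt hsε]
  rw [hθsq]
  exact pow_le_pow_left₀ (momentumParam_nonneg (by positivity) (by linarith))
    (momentumParam_le (by positivity) hθ) 2

theorem tikhonovEnergy_step_le [CompleteSpace H] {ε : ℝ} {z u v y : H}
    (hf : ConvexOn ℝ Set.univ f) (hdiff : Differentiable ℝ f)
    (hlip : LipschitzWith L (gradient f)) (hδ : 0 ≤ δ) (hs : 0 ≤ s) (hε : 0 ≤ ε)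
    (hsL : s * (L + ε) ≤ 1) (hθ : δ * √(s * ε) ≤ 1)
    (hz : IsMinimizer (tikhonovReg f ε) z) (hy : y = u + (1 - δ * √(s * ε)) • (u - v)) :
    tikhonovEnergy f δ s ε z (y - s • (gradient f y + ε • y)) u
      ≤ (1 - momentumParam (δ * √(s * ε)) / (4 * (1 + δ ^ 2))) * tikhonovEnergy f δ s ε z u v := by
  have hθ0 : 0 ≤ δ * √(s * ε) := by positivity
  have hK : LipschitzWith (L + ‖ε‖₊) fun w => gradient f w + ε • w :=
    hlip.add (lipschitzWith_smul ε)
  have hsK : s * ((L + ‖ε‖₊ : NNReal) : ℝ) ≤ 1 := by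
    rwa [NNReal.coe_add, coe_nnnorm, Real.norm_of_nonneg hε]
  rw [← one_sub_momentumParam_div (by linarith)] at hy
  exact lyapunov_inertial_step_le_mul (strongConvexOn_tikhonovReg hf ε) hε
    (fun w => hasGradientAt_tikhonovReg (hdiff w).hasGradientAt ε) hK hs hsK
    (momentumParam_nonneg hθ0 (by linarith)) ((momentumParam_le hθ0 hθ).trans hθ)
    (momentumParam_sq_le hδ (mul_nonneg hs hε) hθ) hz hy

theorem tikhonovEnergy_drift_le {ε ε' R ζ : ℝ} {z z' : H} (hf : ConvexOn ℝ Set.univ f)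
    (hδ : 0 < δ) (hs : 0 < s) (hε : 0 < ε) (hε' : 0 ≤ ε') (hεε' : ε' ≤ ε) (hθ : δ * √(s * ε) ≤ 1)
    (hz : IsMinimizer (tikhonovReg f ε) z) (hz' : IsMinimizer (tikhonovReg f ε') z')
    (hzR : ‖z‖ ≤ R) (hz'R : ‖z'‖ ≤ R) (hζ : 0 < ζ) (u v : H) :
    tikhonovEnergy f δ s ε' z' u v
      ≤ (1 + ζ) * (1 + 4 * (1 - ε' / ε)) * tikhonovEnergy f δ s ε z u v
        + 2 * s * R ^ 2 * (ε - ε')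
        + (1 + 1 / ζ) * (momentumParam (δ * √(s * ε)) ^ 2 * (2 * R * (1 - ε' / ε)) ^ 2) := by
  have hθ0 : 0 < δ * √(s * ε) := by positivity
  have hratio : ε' / ε ≤ δ * √(s * ε') / (δ * √(s * ε)) := by
    have hle : ε' / ε ≤ 1 := (div_le_one hε).2 hεε'
    rw [mul_div_mul_left _ _ hδ.ne', ← Real.sqrt_div' _ (by positivity),
      mul_div_mul_left _ _ hs.ne']
    exact Real.le_sqrt_of_sq_le (pow_le_of_le_one (by positivity) hle two_ne_zero)
  obtain ⟨ρ, hρ0, hρ1, hρ, hparam⟩ := exists_momentumParam_eq_one_sub_mul hθ0 hθ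
    (by positivity : 0 ≤ δ * √(s * ε')) (by gcongr)
  have hτ0 := momentumParam_nonneg hθ0.le (hθ.trans one_le_two)
  have hτ1 := (momentumParam_le hθ0.le hθ).trans hθ
  have hdrift := lyapunov_tikhonovReg_drift_le hεε' hz hz' hs.le hρ0 hρ1 hτ0 hζ u v
  rw [← hparam] at hdrift
  refine hdrift.trans ?_
  have hE := lyapunov_nonneg hs.le hz (momentumParam (δ * √(s * ε))) u v
  have hpath : ‖z - z'‖ ≤ 2 * R * (1 - ε' / ε) := by
    rw [norm_sub_rev]
    exact norm_sub_minimizers_le hf hε' hε hεε' hz' hz hz'R hzR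
  have hvalue : (1 + momentumParam (δ * √(s * ε))) ^ 2 * (s * ((ε - ε') / 2 * ‖z'‖ ^ 2))
      ≤ (1 + 1) ^ 2 * (s * ((ε - ε') / 2 * R ^ 2)) := by
    have := sub_nonneg.2 hεε'
    gcongr
  have hfactor : 1 + 2 * ρ ≤ 1 + 4 * (1 - ε' / ε) := by linarith
  rw [tikhonovEnergy]
  refine add_le_add (add_le_add ?_ (hvalue.trans_eq (by ring))) ?_ <;> gcongr

theorem tikhonovEnergy_drift_le_of_slow {ε ε' R t : ℝ} {z z' : H} (hf : ConvexOn ℝ Set.univ f)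
    (hδ : 0 < δ) (hs : 0 < s) (hε : 0 < ε) (hε' : 0 ≤ ε') (hεε' : ε' ≤ ε) (hθ : δ * √(s * ε) ≤ 1)
    (hz : IsMinimizer (tikhonovReg f ε) z) (hz' : IsMinimizer (tikhonovReg f ε') z')
    (hzR : ‖z‖ ≤ R) (hz'R : ‖z'‖ ≤ R) (ht0 : 0 < t) (ht1 : t ≤ 1)
    (hslow : 16 * (1 - ε' / ε) ≤ t) (u v : H) :
    tikhonovEnergy f δ s ε' z' u v
      ≤ (1 + t / 4) ^ 2 * tikhonovEnergy f δ s ε z u v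
        + 2 * (1 + δ ^ 2) * s * R ^ 2 * (ε - ε') := by
  have hdrift := tikhonovEnergy_drift_le hf hδ hs hε hε' hεε' hθ hz hz' hzR hz'R
    (by positivity : 0 < t / 4) u v
  have hτsq := momentumParam_sq_le hδ.le (by positivity) hθ
  have hE := lyapunov_nonneg hs.le hz (momentumParam (δ * √(s * ε))) u v
  rw [← tikhonovEnergy] at hE
  set τ := momentumParam (δ * √(s * ε))
  set σ := 1 - ε' / ε with hσ
  have hσ0 : 0 ≤ σ := sub_nonneg.2 ((div_le_one hε).2 hεε')
  -- `σ` occurs squared: one factor pays for the `1 / t` of Young's inequality, and the other one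
  -- turns `ε` into `ε - ε'`.
  have hmove : (1 + 1 / (t / 4)) * (τ ^ 2 * (2 * R * σ) ^ 2) ≤ 2 * δ ^ 2 * s * R ^ 2 * (ε - ε') :=
    calc (1 + 1 / (t / 4)) * (τ ^ 2 * (2 * R * σ) ^ 2)
        = (1 / t) * (t + 4) * (4 * σ) * (τ ^ 2 * R ^ 2 * σ) := by
          field_simp
          ring
      _ ≤ (1 / t) * (1 + 4) * (t / 4) * (δ ^ 2 * (s * ε) * R ^ 2 * σ) := by
          gcongr
          linarith
      _ = 5 / 4 * (δ ^ 2 * s * R ^ 2 * (ε - ε')) := by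
          rw [hσ]
          field_simp
          ring
      _ ≤ 2 * δ ^ 2 * s * R ^ 2 * (ε - ε') := by
          have : 0 ≤ δ ^ 2 * s * R ^ 2 * (ε - ε') :=
            mul_nonneg (by positivity) (sub_nonneg.2 hεε')
          linarith
  have hfactor : (1 + t / 4) * (1 + 4 * σ) * tikhonovEnergy f δ s ε z u v
      ≤ (1 + t / 4) ^ 2 * tikhonovEnergy f δ s ε z u v := by
    rw [sq]
    gcongr
    linarith
  linarith

theorem sq_one_add_mul_one_sub_le {t : ℝ} (ht0 : 0 ≤ t) :
    (1 + t / 4) ^ 2 * (1 - t) ≤ 1 - t / 2 := by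
  nlinarith [mul_nonneg ht0 ht0, mul_nonneg (mul_nonneg ht0 ht0) ht0]

theorem tikhonovEnergy_succ_le [CompleteSpace H] {ε ε' R : ℝ} {z z' u v y : H}
    (hf : ConvexOn ℝ Set.univ f) (hdiff : Differentiable ℝ f)
    (hlip : LipschitzWith L (gradient f)) (hδ : 0 < δ) (hs : 0 < s)
    (hε : 0 < ε) (hε' : 0 ≤ ε') (hεε' : ε' ≤ ε) (hsL : s * (L + ε) ≤ 1) (hθ : δ * √(s * ε) ≤ 1)
    (hslow : 128 * (1 + δ ^ 2) * (1 - ε' / ε) ≤ δ * √(s * ε))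
    (hz : IsMinimizer (tikhonovReg f ε) z) (hz' : IsMinimizer (tikhonovReg f ε') z')
    (hzR : ‖z‖ ≤ R) (hz'R : ‖z'‖ ≤ R) (hy : y = u + (1 - δ * √(s * ε)) • (u - v)) :
    tikhonovEnergy f δ s ε' z' (y - s • (gradient f y + ε • y)) u
      ≤ (1 - δ * √(s * ε) / (16 * (1 + δ ^ 2))) * tikhonovEnergy f δ s ε z u v
        + 2 * (1 + δ ^ 2) * s * R ^ 2 * (ε - ε') := by
  have hθ0 : 0 < δ * √(s * ε) := by positivity
  have hτθ := half_le_momentumParam hθ0.le (by linarith)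
  have hτ1 := (momentumParam_le hθ0.le hθ).trans hθ
  have hstep := tikhonovEnergy_step_le hf hdiff hlip hδ.le hs.le hε.le hsL hθ hz hy
  have hE := lyapunov_nonneg hs.le hz (momentumParam (δ * √(s * ε))) u v
  rw [← tikhonovEnergy] at hE
  set t := momentumParam (δ * √(s * ε)) / (4 * (1 + δ ^ 2))
  have ht : δ * √(s * ε) / (8 * (1 + δ ^ 2)) ≤ t := by
    rw [div_le_div_iff₀ (by positivity) (by positivity)]
    nlinarith [sq_nonneg δ]
  have ht0 : 0 < t := lt_of_lt_of_le (by positivity) ht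
  have ht1 : t ≤ 1 := (div_le_one (by positivity)).2 (by nlinarith)
  have hσt : 16 * (1 - ε' / ε) ≤ t :=
    ((le_div_iff₀ (by positivity)).2 (by linarith)).trans ht
  refine (tikhonovEnergy_drift_le_of_slow hf hδ hs hε hε' hεε' hθ hz hz' hzR hz'R ht0 ht1 hσt
    _ _).trans (add_le_add_left ?_ _)
  calc (1 + t / 4) ^ 2 * tikhonovEnergy f δ s ε z (y - s • (gradient f y + ε • y)) u
      ≤ (1 + t / 4) ^ 2 * ((1 - t) * tikhonovEnergy f δ s ε z u v) := by gcongr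
    _ ≤ (1 - t / 2) * tikhonovEnergy f δ s ε z u v := by
        rw [← mul_assoc]
        exact mul_le_mul_of_nonneg_right (sq_one_add_mul_one_sub_le ht0.le) hE
    _ ≤ _ := by
        refine mul_le_mul_of_nonneg_right (sub_le_sub_left ?_ 1) hE
        refine le_trans (le_of_eq ?_) (div_le_div_of_nonneg_right ht zero_le_two)
        field_simp
        norm_num

end TikhonovEnergy

section Recursion

variable {e : ℕ → ℝ}

theorem rpow_neg_mul_one_sub_le {b t : ℝ} (hb : 0 ≤ b) (ht : 0 < t) :
    t ^ (-b) * (1 - b / t) ≤ (t + 1) ^ (-b) := by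
  have hsplit : t + 1 = t * (1 + t⁻¹) := by field_simp
  have hbase : 0 < 1 + t⁻¹ := by positivity
  rw [hsplit, Real.mul_rpow ht.le hbase.le]
  refine mul_le_mul_of_nonneg_left ?_ (by positivity)
  calc 1 - b / t ≤ Real.exp (-(b / t)) := Real.one_sub_le_exp_neg _
    _ = Real.exp t⁻¹ ^ (-b) := by
        rw [← Real.exp_mul]
        congr 1
        ring
    _ ≤ (1 + t⁻¹) ^ (-b) :=
        Real.rpow_le_rpow_of_nonpos hbase (by linarith [Real.add_one_le_exp t⁻¹]) (by linarith)

theorem tendsto_natCast_rpow_neg {θ : ℝ} (hθ : 0 < θ) :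
    Tendsto (fun k : ℕ => (k : ℝ) ^ (-θ)) atTop (𝓝 0) :=
  (tendsto_rpow_neg_atTop hθ).comp tendsto_natCast_atTop_atTop

theorem eventually_div_le_mul_rpow_neg {θ η : ℝ} (hθ : θ < 1) (hη : 0 < η) (b : ℝ) :
    ∀ᶠ k : ℕ in atTop, b / (k : ℝ) ≤ η * (k : ℝ) ^ (-θ) := by
  have hlim := (tendsto_natCast_rpow_neg (sub_pos.2 hθ)).const_mul b
  rw [mul_zero] at hlim
  filter_upwards [hlim.eventually_le_const hη, eventually_gt_atTop 0] with k hk hk0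
  have hk0' : (0 : ℝ) < k := Nat.cast_pos.2 hk0
  calc b / (k : ℝ) = b * (k : ℝ) ^ (-(1 - θ)) * (k : ℝ) ^ (-θ) := by
        rw [mul_assoc, ← Real.rpow_add hk0', div_eq_mul_inv, ← Real.rpow_neg_one]
        congr 2
        ring
    _ ≤ η * (k : ℝ) ^ (-θ) := by gcongr

theorem isBigO_of_eventually_succ_le {a g r : ℕ → ℝ} {C η : ℝ} (hη : 0 < η)
    (he0 : ∀ᶠ k in atTop, 0 ≤ e k) (ha : ∀ᶠ k in atTop, 0 ≤ a k) (hg0 : ∀ᶠ k in atTop, 0 < g k)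
    (hr : ∀ᶠ k in atTop, 0 ≤ r k) (he : ∀ᶠ k in atTop, e (k + 1) ≤ a k * e k + C * r k)
    (hg : ∀ᶠ k in atTop, a k * g k + η * r k ≤ g (k + 1)) : e =O[atTop] g := by
  obtain ⟨K, hK⟩ := eventually_atTop.1 (he0.and (ha.and (hr.and (he.and (hg.and hg0)))))
  set M := max (C / η) (e K / g K)
  have hCM : C ≤ M * η := (div_le_iff₀ hη).1 (le_max_left _ _)
  have hM : 0 ≤ M := le_max_of_le_right (div_nonneg (hK K le_rfl).1 (hK K le_rfl).2.2.2.2.2.le)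
  have hbound : ∀ k ≥ K, e k ≤ M * g k := fun k hk => by
    induction k, hk using Nat.le_induction with
    | base => exact (div_le_iff₀ (hK K le_rfl).2.2.2.2.2).1 (le_max_right _ _)
    | succ k hk ih =>
      obtain ⟨-, hak, hrk, hek, hgk, -⟩ := hK k hk
      calc e (k + 1) ≤ a k * (M * g k) + M * η * r k := hek.trans (by gcongr)
        _ = M * (a k * g k + η * r k) := by ring
        _ ≤ M * g (k + 1) := by gcongr
  refine IsBigO.of_bound M ?_
  filter_upwards [eventually_ge_atTop K, he0, hg0] with k hk hek hgk
  rw [Real.norm_of_nonneg hek, Real.norm_of_nonneg hgk.le]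
  exact hbound k hk

theorem isBigO_rpow_neg_of_eventually_succ_le {θ b c C : ℝ} (hθ0 : 0 < θ) (hθ1 : θ < 1)
    (hb : 0 ≤ b) (hc : 0 < c) (he0 : ∀ᶠ k in atTop, 0 ≤ e k)
    (he : ∀ᶠ k : ℕ in atTop,
      e (k + 1) ≤ (1 - c * (k : ℝ) ^ (-θ)) * e k + C * (k : ℝ) ^ (-(b + θ))) :
    e =O[atTop] fun k => (k : ℝ) ^ (-b) := by
  have hcontr := (tendsto_natCast_rpow_neg hθ0).const_mul c
  rw [mul_zero] at hcontr
  refine isBigO_of_eventually_succ_le (half_pos hc) he0 ?_ ?_ (.of_forall fun k => by positivity)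
    he ?_
  · filter_upwards [hcontr.eventually_le_const one_pos] with k hk using sub_nonneg.2 hk
  · filter_upwards [eventually_gt_atTop 0] with k hk
    have : (0 : ℝ) < k := Nat.cast_pos.2 hk
    positivity
  · filter_upwards [eventually_gt_atTop 0, eventually_div_le_mul_rpow_neg hθ1 (half_pos hc) b]
      with k hk hbk
    have hk0 : (0 : ℝ) < k := Nat.cast_pos.2 hk
    calc (1 - c * (k : ℝ) ^ (-θ)) * (k : ℝ) ^ (-b) + c / 2 * (k : ℝ) ^ (-(b + θ))
        = (k : ℝ) ^ (-b) * (1 - c / 2 * (k : ℝ) ^ (-θ)) := by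
          rw [neg_add, Real.rpow_add hk0]
          ring
      _ ≤ (k : ℝ) ^ (-b) * (1 - b / k) := by gcongr
      _ ≤ ((k + 1 : ℕ) : ℝ) ^ (-b) := by
          rw [Nat.cast_add_one]
          exact rpow_neg_mul_one_sub_le hb hk0

theorem tendsto_of_isBigO_sq_norm_sub {E : Type*} [SeminormedAddCommGroup E] {x z : ℕ → E}
    {b : ℝ} {w : E} (hb : 0 < b)
    (hdist : (fun k => ‖x k - z k‖ ^ 2) =O[atTop] fun k : ℕ => (k : ℝ) ^ (-b))
    (hz : Tendsto z atTop (𝓝 w)) : Tendsto x atTop (𝓝 w) := by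
  have hsub : Tendsto (fun k => x k - z k) atTop (𝓝 0) := by
    rw [tendsto_zero_iff_norm_tendsto_zero]
    simpa only [Real.sqrt_sq (norm_nonneg _), Real.sqrt_zero]
      using (hdist.trans_tendsto (tendsto_natCast_rpow_neg hb)).sqrt
  simpa only [sub_add_cancel, zero_add] using hsub.add hz

end Recursion

section Rates

variable {H : Type*} [NormedAddCommGroup H] [InnerProductSpace ℝ H]
  {f : H → ℝ} {L : NNReal} {δ s p : ℝ} {x y z : ℕ → H}

theorem mul_sqrt_mul_rpow_neg (hs : 0 ≤ s) (δ p : ℝ) {t : ℝ} (ht : 0 ≤ t) :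
    δ * √(s * t ^ (-p)) = δ * √s * t ^ (-(p / 2)) := by
  rw [Real.sqrt_mul hs, Real.sqrt_eq_rpow (t ^ (-p)), ← Real.rpow_mul ht, mul_assoc]
  congr 3
  ring

theorem tendsto_mul_sqrt_mul_rpow_neg (hp : 0 < p) (δ s : ℝ) :
    Tendsto (fun k : ℕ => δ * √(s * (k : ℝ) ^ (-p))) atTop (𝓝 0) := by
  simpa only [mul_zero, Real.sqrt_zero]
    using ((tendsto_natCast_rpow_neg hp).const_mul s).sqrt.const_mul δ

theorem IsTRIGA.eventually_tikhonovEnergy_succ_le [CompleteSpace H] {R : ℝ} (hp0 : 0 < p)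
    (hp2 : p < 2) (hδ : 0 < δ) (hs : 0 < s) (hsL : s * (L : ℝ) < 1) (hf : ConvexOn ℝ Set.univ f)
    (hdiff : Differentiable ℝ f) (hlip : LipschitzWith L (gradient f))
    (hrun : IsTRIGA f δ s (fun k => (k : ℝ) ^ (-p)) x y)
    (hz : ∀ k : ℕ, 1 ≤ k → IsMinimizer (tikhonovReg f ((k : ℝ) ^ (-p))) (z k))
    (hzR : ∀ k, 1 ≤ k → ‖z k‖ ≤ R) :
    ∀ᶠ k : ℕ in atTop,
      tikhonovEnergy f δ s (((k + 1 : ℕ) : ℝ) ^ (-p)) (z (k + 1)) (x (k + 1)) (x k)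
        ≤ (1 - δ * √s / (16 * (1 + δ ^ 2)) * (k : ℝ) ^ (-(p / 2)))
            * tikhonovEnergy f δ s ((k : ℝ) ^ (-p)) (z k) (x k) (x (k - 1))
          + 2 * (1 + δ ^ 2) * s * R ^ 2 * p * (k : ℝ) ^ (-(1 + p / 2 + p / 2)) := by
  have hstepsize : Tendsto (fun k : ℕ => s * (L + (k : ℝ) ^ (-p))) atTop (𝓝 (s * (L + 0))) :=
    ((tendsto_natCast_rpow_neg hp0).const_add _).const_mul s
  filter_upwards [eventually_ge_atTop 1,
    hstepsize.eventually_le_const (by rwa [add_zero]),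
    (tendsto_mul_sqrt_mul_rpow_neg hp0 δ s).eventually_le_const one_pos,
    eventually_div_le_mul_rpow_neg (θ := p / 2) (η := δ * √s / (128 * (1 + δ ^ 2)))
      (by linarith) (by positivity) p] with k hk hsK hθ hpk
  have hk0 : (0 : ℝ) < k := Nat.cast_pos.2 hk
  have hdecay := rpow_neg_mul_one_sub_le hp0.le hk0
  rw [← Nat.cast_add_one] at hdecay
  have hε : 0 < (k : ℝ) ^ (-p) := by positivity
  have hslow : 128 * (1 + δ ^ 2) * (1 - ((k + 1 : ℕ) : ℝ) ^ (-p) / (k : ℝ) ^ (-p))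
      ≤ δ * √(s * (k : ℝ) ^ (-p)) := by
    rw [mul_sqrt_mul_rpow_neg hs.le δ p hk0.le]
    rw [div_mul_eq_mul_div, le_div_iff₀' (by positivity)] at hpk
    refine (mul_le_mul_of_nonneg_left ?_ (by positivity)).trans hpk
    rw [sub_le_comm, le_div_iff₀' hε]
    exact hdecay
  have hdrop : (k : ℝ) ^ (-p) - ((k + 1 : ℕ) : ℝ) ^ (-p)
      ≤ p * (k : ℝ) ^ (-(1 + p / 2 + p / 2)) := by
    have hexp : -(1 + p / 2 + p / 2) = -p - 1 := by ring
    rw [mul_sub, mul_one, mul_div_left_comm] at hdecay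
    rw [hexp, Real.rpow_sub_one hk0.ne']
    exact sub_le_comm.1 hdecay
  obtain ⟨hy, hx⟩ := hrun k hk
  rw [hx]
  refine (tikhonovEnergy_succ_le hf hdiff hlip hδ hs hε (by positivity)
    (Real.rpow_le_rpow_of_nonpos hk0 (by simp) (by linarith)) hsK hθ hslow (hz k hk)
    (hz (k + 1) (by omega)) (hzR k hk) (hzR (k + 1) (by omega)) hy).trans ?_
  rw [mul_sqrt_mul_rpow_neg hs.le δ p hk0.le, mul_div_right_comm, mul_assoc _ p]
  gcongr

theorem IsTRIGA.isBigO_tikhonovEnergy [CompleteSpace H] {z₀ : H} (hp0 : 0 < p) (hp2 : p < 2)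
    (hδ : 0 < δ) (hs : 0 < s) (hsL : s * (L : ℝ) < 1) (hf : ConvexOn ℝ Set.univ f)
    (hdiff : Differentiable ℝ f) (hlip : LipschitzWith L (gradient f)) (hz₀ : IsMinimizer f z₀)
    (hrun : IsTRIGA f δ s (fun k => (k : ℝ) ^ (-p)) x y)
    (hz : ∀ k : ℕ, 1 ≤ k → IsMinimizer (tikhonovReg f ((k : ℝ) ^ (-p))) (z k)) :
    (fun k : ℕ => tikhonovEnergy f δ s ((k : ℝ) ^ (-p)) (z k) (x k) (x (k - 1)))
      =O[atTop] fun k => (k : ℝ) ^ (-(1 + p / 2)) := by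
  have hbound : ∀ k : ℕ, 1 ≤ k → ‖z k‖ ≤ ‖z₀‖ := fun k hk =>
    norm_le_of_isMinimizer_tikhonovReg (Real.rpow_pos_of_pos (Nat.cast_pos.2 hk) _) hz₀ (hz k hk)
  refine isBigO_rpow_neg_of_eventually_succ_le (θ := p / 2) (half_pos hp0) (by linarith)
    (by positivity) (by positivity) ?_
    (hrun.eventually_tikhonovEnergy_succ_le hp0 hp2 hδ hs hsL hf hdiff hlip hz hbound)
  filter_upwards [eventually_ge_atTop 1] with k hk
  exact lyapunov_nonneg hs.le (hz k hk) _ _ _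

theorem isBigO_sub_of_isBigO_tikhonovEnergy {z₀ : H} (hp0 : 0 < p) (hp2 : p < 2) (hδ : 0 ≤ δ)
    (hs : 0 < s) (hz₀ : IsMinimizer f z₀)
    (hz : ∀ k : ℕ, 1 ≤ k → IsMinimizer (tikhonovReg f ((k : ℝ) ^ (-p))) (z k))
    (hE : (fun k : ℕ => tikhonovEnergy f δ s ((k : ℝ) ^ (-p)) (z k) (x k) (x (k - 1)))
      =O[atTop] fun k => (k : ℝ) ^ (-(1 + p / 2))) :
    (fun k => f (x k) - f z₀) =O[atTop] fun k : ℕ => (k : ℝ) ^ (-p) := by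
  have hrate : (fun k : ℕ => (k : ℝ) ^ (-(1 + p / 2))) =O[atTop] fun k => (k : ℝ) ^ (-p) := by
    refine .of_norm_eventuallyLE ?_
    filter_upwards [eventually_ge_atTop 1] with k hk
    rw [Real.norm_of_nonneg (by positivity)]
    exact Real.rpow_le_rpow_of_exponent_le (Nat.one_le_cast.2 hk) (by linarith)
  have hbias : (fun k : ℕ => s * ((k : ℝ) ^ (-p) / 2 * ‖z₀‖ ^ 2)) =O[atTop]
      fun k => (k : ℝ) ^ (-p) := by
    refine IsBigO.of_bound (s / 2 * ‖z₀‖ ^ 2) (.of_forall fun k => le_of_eq ?_)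
    rw [Real.norm_of_nonneg (by positivity), Real.norm_of_nonneg (by positivity)]
    ring
  refine (isBigO_const_mul_left_iff hs.ne').1 (.trans ?_ ((hE.trans hrate).add hbias))
  refine .of_norm_eventuallyLE ?_
  filter_upwards [eventually_ge_atTop 1,
    (tendsto_mul_sqrt_mul_rpow_neg hp0 δ s).eventually_le_const two_pos] with k hk hθ
  rw [Real.norm_of_nonneg (mul_nonneg hs.le (sub_nonneg.2 (hz₀ _)))]
  exact mul_sub_le_tikhonovEnergy hδ hs.le (by positivity) hθ (hz k hk) _ _

theorem isBigO_sq_norm_sub_of_isBigO_tikhonovEnergy (hp0 : 0 < p) (hδ : 0 ≤ δ) (hs : 0 < s)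
    (hf : ConvexOn ℝ Set.univ f)
    (hz : ∀ k : ℕ, 1 ≤ k → IsMinimizer (tikhonovReg f ((k : ℝ) ^ (-p))) (z k))
    (hE : (fun k : ℕ => tikhonovEnergy f δ s ((k : ℝ) ^ (-p)) (z k) (x k) (x (k - 1)))
      =O[atTop] fun k => (k : ℝ) ^ (-(1 + p / 2))) :
    (fun k => ‖x k - z k‖ ^ 2) =O[atTop] fun k : ℕ => (k : ℝ) ^ (-((2 - p) / 2)) := by
  have hweighted : (fun k : ℕ => (k : ℝ) ^ (-p) * ‖x k - z k‖ ^ 2) =O[atTop]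
      fun k => (k : ℝ) ^ (-(1 + p / 2)) := by
    refine (isBigO_const_mul_left_iff (half_pos hs).ne').1 (.trans (.of_norm_eventuallyLE ?_) hE)
    filter_upwards [eventually_ge_atTop 1,
      (tendsto_mul_sqrt_mul_rpow_neg hp0 δ s).eventually_le_const two_pos] with k hk hθ
    rw [Real.norm_of_nonneg (by positivity)]
    refine le_trans (le_of_eq ?_)
      (mul_sq_norm_sub_le_tikhonovEnergy hf hδ hs.le hθ (hz k hk) (x k) (x (k - 1)))
    ring
  refine ((isBigO_refl (fun k : ℕ => (k : ℝ) ^ p) atTop).mul hweighted).congr' ?_ ?_ <;>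
    filter_upwards [eventually_ge_atTop 1] with k hk
  · rw [← mul_assoc, ← Real.rpow_add (Nat.cast_pos.2 hk), add_neg_cancel, Real.rpow_zero, one_mul]
  · rw [← Real.rpow_add (Nat.cast_pos.2 hk)]
    congr 1
    ring

theorem isBigO_norm_sub_of_isBigO_tikhonovEnergy (hp0 : 0 < p) (hδ : 0 ≤ δ) (hs : 0 ≤ s)
    (hz : ∀ k : ℕ, 1 ≤ k → IsMinimizer (tikhonovReg f ((k : ℝ) ^ (-p))) (z k))
    (hE : (fun k : ℕ => tikhonovEnergy f δ s ((k : ℝ) ^ (-p)) (z k) (x k) (x (k - 1)))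
      =O[atTop] fun k => (k : ℝ) ^ (-(1 + p / 2))) :
    (fun k => ‖x k - x (k - 1)‖) =O[atTop] fun k : ℕ => (k : ℝ) ^ (-((2 + p) / 4)) := by
  have hsq : (fun k : ℕ => (k : ℝ) ^ (-((2 + p) / 4))) ^ 2
      = fun k : ℕ => (k : ℝ) ^ (-(1 + p / 2)) := by
    funext k
    rw [Pi.pow_apply, ← Real.rpow_mul_natCast (Nat.cast_nonneg k)]
    congr 1
    push_cast
    ring
  refine .of_pow two_ne_zero ?_
  rw [hsq]
  refine .trans (.of_norm_eventuallyLE ?_) (hE.const_mul_left 4)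
  filter_upwards [eventually_ge_atTop 1,
    (tendsto_mul_sqrt_mul_rpow_neg hp0 δ s).eventually_le_const two_pos] with k hk hθ
  rw [Pi.pow_apply, Real.norm_of_nonneg (by positivity)]
  exact sq_norm_sub_le_lyapunov hs (momentumParam_nonneg (by positivity) hθ) (hz k hk) _ _

end Rates

theorem theorem3p1 {H : Type*} [NormedAddCommGroup H] [InnerProductSpace ℝ H] [CompleteSpace H]
    (f : H → ℝ) (L : NNReal) (δ s p : ℝ) (x y : ℕ → H)
    (hp0 : 0 < p) (hp2 : p < 2) (hδ : 0 < δ) (hs : 0 < s) (hsL : s * (L : ℝ) < 1)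
    (hconv : ConvexOn ℝ Set.univ f) (hdiff : Differentiable ℝ f)
    (hlip : LipschitzWith L (gradient f))
    (hargmin : ∃ z : H, IsMinimizer f z)
    (htriga : IsTRIGA f δ s (fun k : ℕ => 1 / (k : ℝ) ^ p) x y) :
    ∃ (xε : ℕ → H) (xstar : H),
      (∀ k : ℕ, 1 ≤ k → IsUniqueMinimizer (tikhonovReg f (1 / (k : ℝ) ^ p)) (xε k)) ∧
      IsMinNormMinimizer f xstar ∧
      (fun k : ℕ => f (x k) - ⨅ z : H, f z) =O[atTop] (fun k : ℕ => 1 / (k : ℝ) ^ p) ∧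
      (fun k : ℕ => ‖x k - xε k‖ ^ 2) =O[atTop] (fun k : ℕ => 1 / (k : ℝ) ^ ((2 - p) / 2)) ∧
      Tendsto x atTop (𝓝 xstar) ∧
      (fun k : ℕ => ‖x k - x (k - 1)‖) =O[atTop] (fun k : ℕ => 1 / (k : ℝ) ^ ((2 + p) / 4)) := by
  simp only [one_div, ← Real.rpow_neg (Nat.cast_nonneg _)] at htriga ⊢
  obtain ⟨z₀, hz₀⟩ := hargmin
  have hlsc := hdiff.continuous.lowerSemicontinuous
  have hbdd : BddBelow (Set.range f) := ⟨f z₀, Set.forall_mem_range.2 hz₀⟩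
  choose! path hpath using fun ε (hε : 0 < ε) => exists_isMinimizer_tikhonovReg hconv hlsc hbdd hε
  obtain ⟨xstar, hlim⟩ := exists_tendsto_tikhonov_path hconv hz₀ hpath
  have hstar := isMinNormMinimizer_of_tendsto_tikhonov_path hconv hlsc hpath hlim
  have hε (k : ℕ) (hk : 1 ≤ k) : 0 < (k : ℝ) ^ (-p) := Real.rpow_pos_of_pos (Nat.cast_pos.2 hk) _
  have hmin (k : ℕ) (hk : 1 ≤ k) := hpath _ (hε k hk)
  have hε0 : Tendsto (fun k : ℕ => (k : ℝ) ^ (-p)) atTop (𝓝[>] 0) :=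
    tendsto_nhdsWithin_iff.2 ⟨tendsto_natCast_rpow_neg hp0, eventually_atTop.2 ⟨1, hε⟩⟩
  have hE := htriga.isBigO_tikhonovEnergy hp0 hp2 hδ hs hsL hconv hdiff hlip hz₀ hmin
  have hdist := isBigO_sq_norm_sub_of_isBigO_tikhonovEnergy hp0 hδ.le hs hconv hmin hE
  refine ⟨fun k => path ((k : ℝ) ^ (-p)), xstar, fun k hk => (hmin k hk).isUniqueMinimizer
    (strongConvexOn_tikhonovReg hconv _) (hε k hk), hstar, ?_, hdist,
    tendsto_of_isBigO_sq_norm_sub (by linarith) hdist (hlim.comp hε0),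
    isBigO_norm_sub_of_isBigO_tikhonovEnergy hp0 hδ.le hs.le hmin hE⟩
  rw [hstar.1.iInf_eq]
  exact isBigO_sub_of_isBigO_tikhonovEnergy hp0 hp2 hδ.le hs hstar.1 hmin hE
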